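/- Let $\lambda,\lambda_0,L,R>0$, $\mathbf z=[\lambda_0\ L\ R]$, and let $\mathcal D_{\mathbf o}(R)\subset\mathbb R^2$ be the disc of radius $R$ around the target at the origin $\mathbf o$. The obstacle mid-points form a homogeneous Poisson point process (PPP) on $\mathbb R^2$ of intensity $\lambda_0$, and the anchors form a homogeneous PPP on $\mathbb R^2$ of intensity $\lambda$. The obstacle with mid-point $\mathbf m$ is the line segment of length $L$ centred at $\mathbf m$ and perpendicular to the direction of $\mathbf m$ (it faces the target). A point $\mathbf p\in\mathcal D_{\mathbf o}(R)$ is visible, $V(\mathbf p;\mathbf z)=1$, if no obstacle meets the segment from $\mathbf o$ to $\mathbf p$, and otherwise $V(\mathbf p;\mathbf z)=0$; the visible area $A_v(\mathbf z)$ is the area of $\{\mathbf p\in\mathcal D_{\mathbf o}(R):V(\mathbf p;\mathbf z)=1\}$. For $a\ge 0$ let $$g(a;\lambda)=\sum_{k=0}^{2}\frac{e^{-\lambda a}(\lambda a)^k}{k!}$$ be the probability that a Poisson variable of mean $\lambda a$ is less than three. Under independent anchor blocking, the visible anchors are obtained from the anchor process by retaining, conditionally on the anchor process, each anchor independently of all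 the others, an anchor at $\mathbf p\in\mathcal D_{\mathbf o}(R)$ with probability $\mathbb P(V(\mathbf p;\mathbf z)=1)$ and an anchor outside the disc with probability $0$. Let $b^{\rm ind}(\lambda,\mathbf z)$ be the probability that fewer than three anchors in $\mathcal D_{\mathbf o}(R)$ are visible (blind spot probability) under independent blocking. Then the visible anchors form an inhomogeneous PPP with intensity function $\lambda\,\mathbb P(V(\mathbf p;\mathbf z)=1)$ on $\mathcal D_{\mathbf o}(R)$ and $0$ outside; its mean number of points in $\mathcal D_{\mathbf o}(R)$ is $$\int_{\mathcal D_{\mathbf o}(R)}\lambda\,\mathbb P(V(\mathbf p;\mathbf z)=1)\,d\mathbf p=\lambda\,\mathbb E[A_v(\mathbf z)],$$ and $$b^{\rm ind}(\lambda,\mathbf z)=e^{-\lambda\mathbb E[A_v(\mathbf z)]}\left(1+\lambda\mathbb E[A_v(\mathbf z)]+\frac{(\lambda\mathbb E[A_v(\mathbf z)])^2}{2}\right)=g(\mathbb E[A_v(\mathbf z)];\lambda),$$ so that, for a given $\lambda$, it depends only on the mean visible area. -/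

import Mathlib

open MeasureTheory ProbabilityTheory Set
open scoped NNReal ENNReal

namespace BlindSpot

noncomputable section

/-- The Euclidean plane. -/
abbrev Plane : Type := EuclideanSpace ℝ (Fin 2)

/-- A point process on `E` over the sample space `Ω`, given by a measurable enumeration of its
points with multiplicity: the point with label `i` is at `pt i ω`, and it belongs to the
realization exactly when `ω ∈ present i`. -/
structure PointProcess (Ω E : Type*) [MeasurableSpace Ω] [MeasurableSpace E] where
  pt : ℕ → Ω → E
  present : ℕ → Set Ω
  measurable_pt : ∀ i, Measurable (pt i)
  measurableSet_present : ∀ i, MeasurableSet (present i)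

namespace PointProcess

variable {Ω E : Type*} [MeasurableSpace Ω] [MeasurableSpace E]

/-- The number of points of the process that lie in `B`. -/
def count (Φ : PointProcess Ω E) (B : Set E) (ω : Ω) : ℕ∞ :=
  {i : ℕ | ω ∈ Φ.present i ∧ Φ.pt i ω ∈ B}.encard

/-- The σ-algebra on `Ω` generated by the process. -/
@[reducible] def sigma (Φ : PointProcess Ω E) : MeasurableSpace Ω :=
  (⨆ i, MeasurableSpace.comap (Φ.pt i) inferInstance) ⊔
    MeasurableSpace.generateFrom (range Φ.present)

/-- `Φ` is a Poisson point process with intensity measure `Λ`: the numbers of points in finitely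
many pairwise disjoint measurable sets `B i` of finite `Λ`-measure are independent, and each is
Poisson distributed with mean `Λ (B i)`. -/
def IsPoisson (Φ : PointProcess Ω E) (Λ : Measure E) (P : Measure Ω) : Prop :=
  ∀ (n : ℕ) (B : Fin n → Set E), (∀ i, MeasurableSet (B i)) → (∀ i, Λ (B i) < ∞) →
    Pairwise (fun i j => Disjoint (B i) (B j)) → ∀ k : Fin n → ℕ,
      P {ω | ∀ i, Φ.count (B i) ω = (k i : ℕ∞)} = ∏ i, poissonMeasure (Λ (B i)).toNNReal {k i}

/-- `Ψ` is an independent thinning of `Φ` with retention probability `q`: every point of `Ψ` is a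
point of `Φ` and, conditionally on `Φ`, the points of `Φ` are retained independently of one
another, a point at `x` with probability `q x`. -/
structure IsIndependentThinning (Φ Ψ : PointProcess Ω E) (q : E → ℝ) (P : Measure Ω) : Prop where
  pt_eq : Ψ.pt = Φ.pt
  present_subset : ∀ i, Ψ.present i ⊆ Φ.present i
  retention : ∀ s : Finset ℕ,
    P⟦⋂ i ∈ s, Ψ.present i | Φ.sigma⟧ =ᵐ[P]
      fun ω => ∏ i ∈ s, (Φ.present i).indicator (fun ω' => q (Φ.pt i ω')) ω

end PointProcess

/-- The disc of radius `R` around the typical target, which is at the origin. -/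
def disc (R : ℝ) : Set Plane := Metric.closedBall 0 R

/-- The obstacle with mid-point `m`: the line segment of length `L` centred at `m` and
perpendicular to the direction of `m`, so that it faces the target at the origin. -/
def obstacle (L : ℝ) (m : Plane) : Set Plane :=
  {x | ∃ t : ℝ, |t| ≤ L / 2 ∧ x = m + (t * ‖m‖⁻¹) • !₂[-(m 1), m 0]}

section Model

variable {Ω : Type*} [MeasurableSpace Ω]

/-- The visible region: the points `p` of the disc for which no obstacle meets the line of sight
from the target at the origin to `p`. The obstacle mid-points are the points of `Ξ`. -/
def visibleRegion (Ξ : PointProcess Ω Plane) (L R : ℝ) (ω : Ω) : Set Plane :=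
  {p ∈ disc R | ∀ i, ω ∈ Ξ.present i → Disjoint (segment ℝ 0 p) (obstacle L (Ξ.pt i ω))}

/-- The visible area. -/
def visibleArea (Ξ : PointProcess Ω Plane) (L R : ℝ) (ω : Ω) : ℝ :=
  (volume (visibleRegion Ξ L R ω)).toReal

/-- The probability that the point `p` lies in the disc and is visible from the target. -/
def visibleProb (Ξ : PointProcess Ω Plane) (L R : ℝ) (P : Measure Ω) (p : Plane) : ℝ≥0∞ :=
  P {ω | p ∈ visibleRegion Ξ L R ω}

/-- The blind spot probability for a process `Ψ` of visible anchors: the probability that fewer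
than three of them lie in the disc. -/
def blindSpotProb (Ψ : PointProcess Ω Plane) (R : ℝ) (P : Measure Ω) : ℝ :=
  P.real {ω | Ψ.count (disc R) ω < 3}

end Model

/-- `g a lam` is the conditional blind spot probability given a visible region of area `a`: the
probability that `0`, `1` or `2` anchors of a Poisson process of intensity `lam` lie in a region of
area `a`. -/
def g (a : ℝ) (lam : ℝ≥0) : ℝ :=
  ∑ k ∈ Finset.range 3, (poissonMeasure (lam * a.toNNReal)).real {k}

end

end BlindSpot

namespace BlindSpot

open Filter Topology

/-! ### The Poisson distribution -/

/-! The core is the thinning theorem for Poisson processes, proved with generating functionals. For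
a Poisson process, `E ∏ (1 + h x) = exp (∫ h dΛ)` over its points `x`, whenever `‖1 + h‖ ≤ 1` and
`h` vanishes off a set of finite intensity (`IsPoisson.integral_pointProd`). Thinning replaces `h`
by `q h`: the product is expanded over finite sets of labels and the retention probabilities are
inserted by conditioning on the original process (`integral_prod_factor`). The choice `h = ∑ (z j -
1) 1_{B j}` with `‖z j‖ = 1` yields the characteristic function of the retained counts, which is
that of independent Poisson variables with means `∫_{B j} q dΛ` (`IsIndependentThinning.isPoisson`).

The geometry enters only through measurability: the pairs of a point and an obstacle mid-point that
block each other form a closed set, so visibility is jointly measurable and Tonelli's theorem turns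
the integrated visibility probability into the mean visible area (`lintegral_visibleProb`). The
blind spot probability is then read off the Poisson count in the disc. -/

theorem integral_pow_poissonMeasure (r : ℝ≥0) (z : ℂ) :
    ∫ n, z ^ n ∂(poissonMeasure r) = Complex.exp (r * (z - 1)) := by
  rw [integral_poissonMeasure]
  calc ∑' n : ℕ, (Real.exp (-r) * r ^ n / n.factorial) • z ^ n
      = ∑' n : ℕ, Complex.exp (-r) * ((r * z) ^ n / n.factorial) := by
        congr with n
        simp only [Complex.real_smul]
        push_cast
        ring
    _ = Complex.exp (-r) * Complex.exp (r * z) := by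
        rw [tsum_mul_left, Complex.exp_eq_exp_ℂ, NormedSpace.exp_eq_tsum_div]
    _ = Complex.exp (r * (z - 1)) := by
        rw [← Complex.exp_add]
        ring_nf

theorem lintegral_natCast_poissonMeasure (r : ℝ≥0) :
    ∫⁻ n, (n : ℝ≥0∞) ∂(poissonMeasure r) = r := by
  have hr : ENNReal.ofReal r = r := ENNReal.ofReal_coe_nnreal
  rw [lintegral_countable', tsum_eq_zero_add' ENNReal.summable]
  have h (n : ℕ) : ((n + 1 : ℕ) : ℝ≥0∞) * poissonMeasure r {n + 1} = r * poissonMeasure r {n} := by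
    rw [poissonMeasure_singleton, poissonMeasure_singleton, ← ENNReal.ofReal_natCast, ← hr,
      ← ENNReal.ofReal_mul (by positivity), ← ENNReal.ofReal_mul (by positivity)]
    congr 1
    rw [Nat.factorial_succ]
    push_cast
    field_simp
    ring
  simp_rw [h]
  have h1 : ∑' n : ℕ, poissonMeasure r {n} = 1 := by
    have := lintegral_countable' (μ := poissonMeasure r) (fun _ => 1)
    simpa using this.symm
  rw [ENNReal.tsum_mul_left, h1]
  simp

/-- A finite measure on `ι → ℕ` is determined by its Fourier transform. -/
theorem ext_of_integral_prod_pow {ι : Type*} [Fintype ι] {μ ν : Measure (ι → ℕ)}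
    [IsFiniteMeasure μ] [IsFiniteMeasure ν]
    (h : ∀ z : ι → ℂ, (∀ j, ‖z j‖ = 1) → ∫ k, ∏ j, z j ^ k j ∂μ = ∫ k, ∏ j, z j ^ k j ∂ν) :
    μ = ν := by
  -- Counts are embedded in Euclidean space, where characteristic functions determine measures; the
  -- frequency `t` corresponds to `z j = exp (i t j)`.
  let f : (ι → ℕ) → EuclideanSpace ℝ ι := fun k => WithLp.toLp 2 fun j => (k j : ℝ)
  have hf : Measurable f := .of_discrete
  have hinj : Function.Injective f := fun k l hkl => by
    ext j
    have := congrArg (fun x : EuclideanSpace ℝ ι => x j) hkl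
    simpa [f] using this
  have hchar (ρ : Measure (ι → ℕ)) (t : EuclideanSpace ℝ ι) :
      charFun (ρ.map f) t = ∫ k, ∏ j, Complex.exp (t j * Complex.I) ^ k j ∂ρ := by
    rw [charFun_apply, integral_map hf.aemeasurable (by fun_prop)]
    congr with k
    simp_rw [← Complex.exp_nat_mul, ← Complex.exp_sum]
    congr 1
    simp only [f, PiLp.inner_apply, RCLike.inner_apply, conj_trivial]
    push_cast
    rw [Finset.sum_mul]
    exact Finset.sum_congr rfl fun j _ => by ring
  have hmap : μ.map f = ν.map f := by
    apply Measure.ext_of_charFun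
    ext t
    rw [hchar, hchar]
    exact h _ fun j => Complex.norm_exp_ofReal_mul_I _
  refine Measure.ext_of_singleton fun k => ?_
  have hk : f ⁻¹' {f k} = {k} := by
    ext l
    simp [hinj.eq_iff]
  rw [← hk, ← Measure.map_apply hf (measurableSet_singleton _),
    ← Measure.map_apply hf (measurableSet_singleton _), hmap]

namespace PointProcess

variable {Ω E : Type*} [MeasurableSpace Ω] [MeasurableSpace E]
  {Φ : PointProcess Ω E} {Λ : Measure E} {P : Measure Ω}

/-! ### Counts of a Poisson process -/

/-- The labels of the points that lie in `B`. -/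
def labels (Φ : PointProcess Ω E) (B : Set E) (ω : Ω) : Set ℕ :=
  {i | ω ∈ Φ.present i ∧ Φ.pt i ω ∈ B}

/-- The number of points in `B` as a natural number. -/
noncomputable def num (Φ : PointProcess Ω E) (B : Set E) (ω : Ω) : ℕ := (Φ.labels B ω).ncard

theorem measurableSet_mem_labels (Φ : PointProcess Ω E) {B : Set E} (hB : MeasurableSet B)
    (i : ℕ) : MeasurableSet {ω | i ∈ Φ.labels B ω} :=
  (Φ.measurableSet_present i).inter (Φ.measurable_pt i hB)

theorem measurable_labels (Φ : PointProcess Ω E) {B : Set E} (hB : MeasurableSet B) :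
    Measurable (Φ.labels B) :=
  measurable_set_iff.2 fun i => measurableSet_setOfPred.1 (Φ.measurableSet_mem_labels hB i)

theorem measurable_num (Φ : PointProcess Ω E) {B : Set E} (hB : MeasurableSet B) :
    Measurable (Φ.num B) :=
  measurable_ncard.comp (Φ.measurable_labels hB)

/-- Finiteness is essential: on an infinite set of labels `num` takes the default value `0`, whereas
`count` is `⊤`. -/
theorem count_eq_num {B : Set E} {ω : Ω} (h : (Φ.labels B ω).Finite) :
    Φ.count B ω = Φ.num B ω :=
  h.cast_ncard_eq.symm

theorem count_eq_coe_iff {B : Set E} {ω : Ω} (h : (Φ.labels B ω).Finite) {k : ℕ} :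
    Φ.count B ω = k ↔ Φ.num B ω = k := by
  rw [count_eq_num h, Nat.cast_inj]

theorem labels_mono {B C : Set E} (h : B ⊆ C) (ω : Ω) : Φ.labels B ω ⊆ Φ.labels C ω :=
  fun _ hi => ⟨hi.1, h hi.2⟩

/-- Later index types are `Unit` for a single set and the range of a simple function. -/
theorem IsPoisson.measure_eq (hΦ : Φ.IsPoisson Λ P) {ι : Type*} [Fintype ι] {B : ι → Set E}
    (hB : ∀ j, MeasurableSet (B j)) (hfin : ∀ j, Λ (B j) < ∞)
    (hdisj : Pairwise fun i j => Disjoint (B i) (B j)) (k : ι → ℕ) :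
    P {ω | ∀ j, Φ.count (B j) ω = (k j : ℕ∞)} = ∏ j, poissonMeasure (Λ (B j)).toNNReal {k j} := by
  let e := Fintype.equivFin ι
  have := hΦ _ (B ∘ e.symm) (fun i => hB _) (fun i => hfin _)
    (fun i j hij => hdisj (e.symm.injective.ne hij)) (k ∘ e.symm)
  rw [← e.symm.prod_comp]
  simp only [Function.comp_def] at this
  rw [← this]
  congr 1
  ext ω
  simp [e.symm.surjective.forall]

/-- The Poisson masses of the finite values already add up to `1`. -/
theorem IsPoisson.ae_finite [IsProbabilityMeasure P] (hΦ : Φ.IsPoisson Λ P) {B : Set E}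
    (hB : MeasurableSet B) (hfin : Λ B < ∞) : ∀ᵐ ω ∂P, (Φ.labels B ω).Finite := by
  have hm : Measurable (Φ.count B) := measurable_encard.comp (Φ.measurable_labels hB)
  have h1 (k : ℕ) : P {ω | Φ.count B ω = k} = poissonMeasure (Λ B).toNNReal {k} := by
    simpa using hΦ.measure_eq (ι := Unit) (B := fun _ => B) (fun _ => hB) (fun _ => hfin)
      (fun i j hij => (hij rfl).elim) (fun _ => k)
  have h2 : P (⋃ k : ℕ, {ω | Φ.count B ω = k}) = 1 := by
    rw [measure_iUnion]
    · simp_rw [h1]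
      have := lintegral_countable' (μ := poissonMeasure (Λ B).toNNReal) (fun _ => 1)
      simpa using this.symm
    · intro k l hkl
      refine Set.disjoint_left.2 fun ω hk hl => hkl ?_
      exact Nat.cast_injective (R := ℕ∞) (hk.symm.trans hl)
    · exact fun k => hm (measurableSet_singleton _)
  have h3 : ∀ᵐ ω ∂P, ω ∈ ⋃ k : ℕ, {ω | Φ.count B ω = k} :=
    (prob_compl_eq_zero_iff (.iUnion fun k => hm (measurableSet_singleton _))).2 h2
  filter_upwards [h3] with ω hω
  obtain ⟨k, hk⟩ := mem_iUnion.1 hω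
  exact Set.finite_of_encard_eq_coe hk

/-- The joint law of the numbers of points in finitely many disjoint sets. -/
theorem IsPoisson.map_num [IsProbabilityMeasure P] (hΦ : Φ.IsPoisson Λ P) {ι : Type*} [Fintype ι]
    {B : ι → Set E} (hB : ∀ j, MeasurableSet (B j)) (hfin : ∀ j, Λ (B j) < ∞)
    (hdisj : Pairwise fun i j => Disjoint (B i) (B j)) :
    P.map (fun ω j => Φ.num (B j) ω) =
      Measure.pi fun j => poissonMeasure (Λ (B j)).toNNReal := by
  refine Measure.ext_of_singleton fun k => ?_
  rw [Measure.map_apply (measurable_pi_lambda _ fun j => Φ.measurable_num (hB j))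
    (measurableSet_singleton _), Measure.pi_singleton, ← hΦ.measure_eq hB hfin hdisj]
  apply measure_congr
  filter_upwards [ae_all_iff.2 fun j => hΦ.ae_finite (hB j) (hfin j)] with ω hω
  apply propext
  change (fun j => Φ.num (B j) ω) = k ↔ ∀ j, Φ.count (B j) ω = k j
  simp_rw [funext_iff, fun j => count_eq_coe_iff (hω j)]

theorem isPoisson_of_map_num
    (hfinite : ∀ B, MeasurableSet B → Λ B < ∞ → ∀ᵐ ω ∂P, (Φ.labels B ω).Finite)
    (h : ∀ (n : ℕ) (B : Fin n → Set E), (∀ j, MeasurableSet (B j)) → (∀ j, Λ (B j) < ∞) →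
      Pairwise (fun i j => Disjoint (B i) (B j)) →
      P.map (fun ω j => Φ.num (B j) ω) =
        Measure.pi fun j => poissonMeasure (Λ (B j)).toNNReal) :
    Φ.IsPoisson Λ P := by
  intro n B hB hfin hdisj k
  rw [← Measure.pi_singleton, ← h n B hB hfin hdisj,
    Measure.map_apply (measurable_pi_lambda _ fun j => Φ.measurable_num (hB j))
    (measurableSet_singleton _)]
  apply measure_congr
  filter_upwards [ae_all_iff.2 fun j => hfinite _ (hB j) (hfin j)] with ω hω
  apply propext
  change (∀ j, Φ.count (B j) ω = k j) ↔ (fun j => Φ.num (B j) ω) = k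
  simp_rw [funext_iff, fun j => count_eq_coe_iff (hω j)]

theorem IsPoisson.lintegral_count [IsProbabilityMeasure P] (hΦ : Φ.IsPoisson Λ P) {B : Set E}
    (hB : MeasurableSet B) (hfin : Λ B < ∞) :
    ∫⁻ ω, (Φ.count B ω : ℝ≥0∞) ∂P = Λ B := by
  have hmap := hΦ.map_num (ι := Unit) (B := fun _ => B) (fun _ => hB) (fun _ => hfin)
    (fun i j hij => (hij rfl).elim)
  calc ∫⁻ ω, (Φ.count B ω : ℝ≥0∞) ∂P = ∫⁻ ω, (Φ.num B ω : ℝ≥0∞) ∂P := by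
        apply lintegral_congr_ae
        filter_upwards [hΦ.ae_finite hB hfin] with ω hω
        rw [count_eq_num hω]
        simp
    _ = ∫⁻ k : Unit → ℕ, (k () : ℝ≥0∞) ∂(P.map fun ω (_ : Unit) => Φ.num B ω) := by
        rw [lintegral_map .of_discrete (measurable_pi_lambda _ fun _ => Φ.measurable_num hB)]
    _ = Λ B := by
        rw [hmap, (measurePreserving_eval (fun _ : Unit => poissonMeasure (Λ B).toNNReal)
          ()).lintegral_comp (f := fun n : ℕ => (n : ℝ≥0∞)) .of_discrete,
          lintegral_natCast_poissonMeasure, ENNReal.coe_toNNReal hfin.ne]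

end PointProcess

/-! ### Step functions on disjoint sets -/

theorem sum_indicator_eq_of_mem {ι E : Type*} [Fintype ι] {B : ι → Set E}
    (hdisj : Pairwise fun i j => Disjoint (B i) (B j)) (c : ι → ℂ) {x : E} {j : ι} (hx : x ∈ B j) :
    ∑ l, (B l).indicator (fun _ => c l) x = c j := by
  rw [Finset.sum_eq_single j, indicator_of_mem hx]
  · exact fun l _ hl => indicator_of_notMem (fun hxl => Set.disjoint_left.1 (hdisj hl) hxl hx) _
  · simp

theorem sum_indicator_eq_zero {ι E : Type*} [Fintype ι] {B : ι → Set E} (c : ι → ℂ) {x : E}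
    (hx : ∀ j, x ∉ B j) : ∑ l, (B l).indicator (fun _ => c l) x = 0 :=
  Finset.sum_eq_zero fun l _ => indicator_of_notMem (hx l) _

/-- By disjointness at most one indicator is non-zero at `x`. -/
theorem one_add_sum_indicator {ι E : Type*} [Fintype ι] {B : ι → Set E}
    (hdisj : Pairwise fun i j => Disjoint (B i) (B j)) (c : ι → ℂ) (x : E) :
    1 + ∑ j, (B j).indicator (fun _ => c j) x = ∏ j, (1 + (B j).indicator (fun _ => c j) x) := by
  by_cases hx : ∃ j, x ∈ B j
  · obtain ⟨j, hj⟩ := hx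
    rw [sum_indicator_eq_of_mem hdisj c hj, Finset.prod_eq_single j, indicator_of_mem hj]
    · intro l _ hl
      rw [indicator_of_notMem fun hxl => Set.disjoint_left.1 (hdisj hl) hxl hj, add_zero]
    · simp
  · push Not at hx
    rw [sum_indicator_eq_zero c hx, Finset.prod_eq_one fun j _ => by
      rw [indicator_of_notMem (hx j), add_zero], add_zero]

namespace PointProcess

variable {Ω E : Type*} [MeasurableSpace Ω] [MeasurableSpace E]
  {Φ Ψ : PointProcess Ω E} {Λ : Measure E} {P : Measure Ω}

/-! ### The generating functional -/

/-- The contribution of the label `i` to the product `∏ (1 + h x)` over the points `x`. -/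
noncomputable def factor (Φ : PointProcess Ω E) (h : E → ℂ) (ω : Ω) (i : ℕ) : ℂ :=
  1 + (Φ.present i).indicator (fun ω' => h (Φ.pt i ω')) ω

/-- The product of `1 + h x` over the points `x` of the process; it is used for `h` that vanish
outside a set with finitely many points. -/
noncomputable def pointProd (Φ : PointProcess Ω E) (h : E → ℂ) (ω : Ω) : ℂ :=
  ∏ᶠ i, Φ.factor h ω i

theorem factor_of_mem {h : E → ℂ} {ω : Ω} {i : ℕ} (hi : ω ∈ Φ.present i) :
    Φ.factor h ω i = 1 + h (Φ.pt i ω) := by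
  simp [factor, hi]

theorem factor_of_notMem {h : E → ℂ} {ω : Ω} {i : ℕ} (hi : ω ∉ Φ.present i) :
    Φ.factor h ω i = 1 := by
  simp [factor, hi]

/-- This bound keeps all products in the unit disc, so the constant `1` dominates them in the limit
arguments. -/
theorem norm_factor_le {h : E → ℂ} (hh : ∀ x, ‖1 + h x‖ ≤ 1) (ω : Ω) (i : ℕ) :
    ‖Φ.factor h ω i‖ ≤ 1 := by
  by_cases hi : ω ∈ Φ.present i
  · rw [factor_of_mem hi]
    exact hh _
  · simp [factor_of_notMem hi]

theorem norm_prod_factor_le {h : E → ℂ} (hh : ∀ x, ‖1 + h x‖ ≤ 1) (ω : Ω) (s : Finset ℕ) :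
    ‖∏ i ∈ s, Φ.factor h ω i‖ ≤ 1 := by
  rw [norm_prod]
  exact Finset.prod_le_one (fun _ _ => norm_nonneg _) fun i _ => norm_factor_le hh ω i

theorem measurable_factor {h : E → ℂ} (hh : Measurable h) (i : ℕ) :
    Measurable fun ω => Φ.factor h ω i :=
  ((hh.comp (Φ.measurable_pt i)).indicator (Φ.measurableSet_present i)).const_add 1

theorem mulSupport_factor_subset {h : E → ℂ} {B : Set E} (hB : ∀ x, x ∉ B → h x = 0) (ω : Ω) :
    Function.mulSupport (Φ.factor h ω) ⊆ Φ.labels B ω := by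
  intro i hi
  by_contra hi'
  apply hi
  by_cases hp : ω ∈ Φ.present i
  · rw [factor_of_mem hp, hB _ fun hx => hi' ⟨hp, hx⟩, add_zero]
  · exact factor_of_notMem hp

theorem pointProd_eq_prod {h : E → ℂ} {B : Set E} (hB : ∀ x, x ∉ B → h x = 0) {ω : Ω}
    {s : Finset ℕ} (hs : Φ.labels B ω ⊆ s) :
    Φ.pointProd h ω = ∏ i ∈ s, Φ.factor h ω i :=
  finprod_eq_prod_of_mulSupport_subset _ ((mulSupport_factor_subset hB ω).trans hs)

theorem tendsto_prod_factor {h : E → ℂ} {B : Set E} (hB : ∀ x, x ∉ B → h x = 0) {ω : Ω}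
    (hω : (Φ.labels B ω).Finite) :
    Tendsto (fun n => ∏ i ∈ Finset.range n, Φ.factor h ω i) atTop (𝓝 (Φ.pointProd h ω)) := by
  obtain ⟨m, hm⟩ := hω.bddAbove
  refine tendsto_const_nhds.congr' ?_
  filter_upwards [eventually_gt_atTop m] with n hn
  refine pointProd_eq_prod hB fun i hi => ?_
  simpa using (hm hi).trans_lt hn

/-- Retention is prescribed for finite sets of labels only; this limit carries identities from
truncated products to `pointProd`. -/
theorem tendsto_integral_prod_factor [IsProbabilityMeasure P] {h : E → ℂ} {B : Set E}
    (hm : Measurable h) (hh : ∀ x, ‖1 + h x‖ ≤ 1) (hB : ∀ x, x ∉ B → h x = 0)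
    (hfin : ∀ᵐ ω ∂P, (Φ.labels B ω).Finite) :
    Tendsto (fun n => ∫ ω, ∏ i ∈ Finset.range n, Φ.factor h ω i ∂P) atTop
      (𝓝 (∫ ω, Φ.pointProd h ω ∂P)) := by
  refine tendsto_integral_of_dominated_convergence (fun _ => 1) (fun n => ?_)
    (integrable_const _) (fun n => .of_forall fun ω => norm_prod_factor_le hh ω _) ?_
  · exact (Finset.measurable_prod _ fun i _ => measurable_factor hm i).aestronglyMeasurable
  · filter_upwards [hfin] with ω hω using tendsto_prod_factor hB hω

theorem aestronglyMeasurable_pointProd {h : E → ℂ} {B : Set E}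
    (hm : Measurable h) (hB : ∀ x, x ∉ B → h x = 0)
    (hfin : ∀ᵐ ω ∂P, (Φ.labels B ω).Finite) : AEStronglyMeasurable (Φ.pointProd h) P := by
  refine aestronglyMeasurable_of_tendsto_ae atTop
    (f := fun n ω => ∏ i ∈ Finset.range n, Φ.factor h ω i) (fun n => ?_) ?_
  · exact (Finset.measurable_prod _ fun i _ => measurable_factor hm i).aestronglyMeasurable
  · filter_upwards [hfin] with ω hω using tendsto_prod_factor hB hω

theorem norm_pointProd_le {h : E → ℂ} {B : Set E} (hh : ∀ x, ‖1 + h x‖ ≤ 1)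
    (hB : ∀ x, x ∉ B → h x = 0) {ω : Ω} (hω : (Φ.labels B ω).Finite) : ‖Φ.pointProd h ω‖ ≤ 1 := by
  rw [pointProd_eq_prod hB hω.coe_toFinset.ge]
  exact norm_prod_factor_le hh ω _

/-- Group the labels by the set that contains their point: each label in `B j` contributes one
factor `1 + c j`. -/
theorem pointProd_sum_indicator {ι : Type*} [Fintype ι] {B : ι → Set E}
    (hdisj : Pairwise fun i j => Disjoint (B i) (B j)) (c : ι → ℂ) {ω : Ω}
    (hω : ∀ j, (Φ.labels (B j) ω).Finite) :
    Φ.pointProd (fun x => ∑ j, (B j).indicator (fun _ => c j) x) ω =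
      ∏ j, (1 + c j) ^ Φ.num (B j) ω := by
  classical
  have hlabels : Φ.labels (⋃ j, B j) ω = ⋃ j, Φ.labels (B j) ω := by
    ext i
    simp [labels]
  have hfin : (Φ.labels (⋃ j, B j) ω).Finite := by
    rw [hlabels]
    exact finite_iUnion hω
  rw [pointProd_eq_prod (B := ⋃ j, B j) (fun x hx => sum_indicator_eq_zero c (by simpa using hx))
    hfin.coe_toFinset.ge]
  have hfac (i : ℕ) (hi : i ∈ hfin.toFinset) :
      Φ.factor (fun x => ∑ j, (B j).indicator (fun _ => c j) x) ω i =
        ∏ j, if i ∈ Φ.labels (B j) ω then 1 + c j else 1 := by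
    have hp : ω ∈ Φ.present i := (hfin.mem_toFinset.1 hi).1
    rw [factor_of_mem hp, one_add_sum_indicator hdisj]
    refine Finset.prod_congr rfl fun j _ => ?_
    by_cases hx : Φ.pt i ω ∈ B j
    · simp [labels, hx, hp]
    · simp [labels, hx]
  rw [Finset.prod_congr rfl hfac, Finset.prod_comm]
  refine Finset.prod_congr rfl fun j _ => ?_
  rw [← Finset.prod_filter, Finset.prod_const, num, ← ncard_coe_finset]
  congr 2
  ext i
  simp only [Finset.coe_filter, Finite.mem_toFinset, mem_ofPred_eq, and_iff_right_iff_imp]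
  exact fun hi => labels_mono (subset_iUnion B j) ω hi

theorem IsPoisson.integral_pointProd_sum_indicator [IsProbabilityMeasure P]
    (hΦ : Φ.IsPoisson Λ P) {ι : Type*} [Fintype ι] {B : ι → Set E}
    (hB : ∀ j, MeasurableSet (B j)) (hfin : ∀ j, Λ (B j) < ∞)
    (hdisj : Pairwise fun i j => Disjoint (B i) (B j)) (c : ι → ℂ) :
    ∫ ω, Φ.pointProd (fun x => ∑ j, (B j).indicator (fun _ => c j) x) ω ∂P =
      Complex.exp (∫ x, ∑ j, (B j).indicator (fun _ => c j) x ∂Λ) := by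
  have hnum : Measurable fun ω j => Φ.num (B j) ω :=
    measurable_pi_lambda _ fun j => Φ.measurable_num (hB j)
  calc ∫ ω, Φ.pointProd (fun x => ∑ j, (B j).indicator (fun _ => c j) x) ω ∂P
      = ∫ ω, ∏ j, (1 + c j) ^ Φ.num (B j) ω ∂P := by
        apply integral_congr_ae
        filter_upwards [ae_all_iff.2 fun j => hΦ.ae_finite (hB j) (hfin j)] with ω hω
        exact pointProd_sum_indicator hdisj c hω
    _ = ∫ k : ι → ℕ, ∏ j, (1 + c j) ^ k j ∂(P.map fun ω j => Φ.num (B j) ω) := by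
        rw [integral_map hnum.aemeasurable (Measurable.of_discrete.aestronglyMeasurable)]
    _ = ∏ j, Complex.exp ((Λ (B j)).toNNReal * c j) := by
        rw [hΦ.map_num hB hfin hdisj,
          integral_fintype_prod_eq_prod (f := fun j (n : ℕ) => (1 + c j) ^ n)]
        simp_rw [integral_pow_poissonMeasure, add_sub_cancel_left]
    _ = Complex.exp (∫ x, ∑ j, (B j).indicator (fun _ => c j) x ∂Λ) := by
        rw [← Complex.exp_sum, integral_finsetSum]
        · simp_rw [integral_indicator_const _ (hB _)]
          congr 1
        · exact fun j _ => (integrable_indicator_iff (hB j)).2 (integrableOn_const (hfin j).ne)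

/-- The generating functional of a Poisson process. -/
theorem IsPoisson.integral_pointProd [IsProbabilityMeasure P] (hΦ : Φ.IsPoisson Λ P)
    {h : E → ℂ} {B : Set E} (hm : Measurable h) (hh : ∀ x, ‖1 + h x‖ ≤ 1)
    (hB : ∀ x, x ∉ B → h x = 0) (hBm : MeasurableSet B) (hfin : Λ B < ∞) :
    ∫ ω, Φ.pointProd h ω ∂P = Complex.exp (∫ x, h x ∂Λ) := by
  -- This disc encodes `‖1 + y‖ ≤ 1`; approximating within it keeps every simple function
  -- admissible.
  let s : Set ℂ := Metric.closedBall (-1) 1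
  have mem_s (y : ℂ) : y ∈ s ↔ ‖1 + y‖ ≤ 1 := by
    rw [mem_closedBall_iff_norm, sub_neg_eq_add, add_comm]
  have h0 : (0 : ℂ) ∈ s := by simp [mem_s]
  let f : ℕ → SimpleFunc E ℂ := fun n => SimpleFunc.approxOn h hm s 0 h0 n
  -- Cutting off at `B` puts the level sets, even that of the value `0`, inside a set of finite
  -- measure.
  let F : ℕ → E → ℂ := fun n => B.indicator (f n)
  have hFm (n : ℕ) : Measurable (F n) := (f n).measurable.indicator hBm
  have hFB (n : ℕ) (x : E) (hx : x ∉ B) : F n x = 0 := indicator_of_notMem hx _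
  have hFs (n : ℕ) (x : E) : ‖1 + F n x‖ ≤ 1 := by
    by_cases hx : x ∈ B
    · simp only [F, indicator_of_mem hx]
      exact (mem_s _).1 (SimpleFunc.approxOn_mem hm h0 n x)
    · simp [hFB n x hx]
  have hFlim (x : E) : Tendsto (fun n => F n x) atTop (𝓝 (h x)) := by
    by_cases hx : x ∈ B
    · simp only [F, indicator_of_mem hx]
      exact SimpleFunc.tendsto_approxOn hm h0 (subset_closure ((mem_s _).2 (hh x)))
    · simp only [hFB _ x hx, hB x hx]
      exact tendsto_const_nhds
  have hFsum (n : ℕ) : F n = fun x => ∑ c : (f n).range,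
      (B ∩ f n ⁻¹' {(c : ℂ)}).indicator (fun _ => (c : ℂ)) x := by
    ext x
    have hdisj : Pairwise fun c d : (f n).range =>
        Disjoint (B ∩ f n ⁻¹' {(c : ℂ)}) (B ∩ f n ⁻¹' {(d : ℂ)}) := fun c d hcd =>
      Set.disjoint_left.2 fun y hc hd => hcd (Subtype.ext (hc.2.symm.trans hd.2))
    by_cases hx : x ∈ B
    · simp only [F, indicator_of_mem hx]
      exact (sum_indicator_eq_of_mem hdisj (fun c => (c : ℂ))
        (j := ⟨f n x, (f n).mem_range_self x⟩) ⟨hx, rfl⟩).symm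
    · rw [hFB n x hx]
      exact (sum_indicator_eq_zero _ fun c hc => hx hc.1).symm
  have hFeq (n : ℕ) : ∫ ω, Φ.pointProd (F n) ω ∂P = Complex.exp (∫ x, F n x ∂Λ) := by
    rw [hFsum n]
    refine hΦ.integral_pointProd_sum_indicator
      (fun c => hBm.inter ((f n).measurableSet_preimage _))
      (fun c => (measure_mono inter_subset_left).trans_lt hfin) (fun c d hcd => ?_) _
    exact Set.disjoint_left.2 fun y hc hd => hcd (Subtype.ext (hc.2.symm.trans hd.2))
  have hae := hΦ.ae_finite hBm hfin
  have lim1 : Tendsto (fun n => ∫ ω, Φ.pointProd (F n) ω ∂P) atTop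
      (𝓝 (∫ ω, Φ.pointProd h ω ∂P)) := by
    refine tendsto_integral_of_dominated_convergence (fun _ => 1)
      (fun n => aestronglyMeasurable_pointProd (hFm n) (hFB n) hae) (integrable_const _)
      (fun n => ?_) ?_
    · filter_upwards [hae] with ω hω using norm_pointProd_le (hFs n) (hFB n) hω
    · filter_upwards [hae] with ω hω
      simp_rw [fun n => pointProd_eq_prod (hFB n) hω.coe_toFinset.ge,
        pointProd_eq_prod hB hω.coe_toFinset.ge]
      refine tendsto_finsetProd _ fun i hi => ?_
      have hp : ω ∈ Φ.present i := (hω.mem_toFinset.1 hi).1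
      simp_rw [factor_of_mem hp]
      exact (hFlim _).const_add 1
  have lim2 : Tendsto (fun n => ∫ x, F n x ∂Λ) atTop (𝓝 (∫ x, h x ∂Λ)) := by
    refine tendsto_integral_of_dominated_convergence (B.indicator fun _ => 2)
      (fun n => (hFm n).aestronglyMeasurable) ?_ (fun n => .of_forall fun x => ?_)
      (.of_forall hFlim)
    · exact (integrable_indicator_iff hBm).2 (integrableOn_const hfin.ne)
    · by_cases hx : x ∈ B
      · rw [indicator_of_mem hx]
        calc ‖F n x‖ = ‖(1 + F n x) - 1‖ := by ring_nf
          _ ≤ ‖1 + F n x‖ + ‖(1 : ℂ)‖ := norm_sub_le _ _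
          _ ≤ 2 := by
            have := hFs n x
            rw [norm_one]
            linarith
      · simp [hFB n x hx, hx]
  simp_rw [hFeq] at lim1
  exact tendsto_nhds_unique lim1 ((Complex.continuous_exp.tendsto _).comp lim2)

/-! ### Independent thinning -/

theorem sigma_le (Φ : PointProcess Ω E) : Φ.sigma ≤ ‹MeasurableSpace Ω› := by
  refine sup_le (iSup_le fun i => (Φ.measurable_pt i).comap_le) ?_
  refine MeasurableSpace.generateFrom_le ?_
  rintro _ ⟨i, rfl⟩
  exact Φ.measurableSet_present i

theorem measurable_pt_sigma (Φ : PointProcess Ω E) (i : ℕ) : Measurable[Φ.sigma] (Φ.pt i) := by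
  refine (comap_measurable (Φ.pt i)).mono ?_ le_rfl
  exact (le_iSup (fun i => MeasurableSpace.comap (Φ.pt i) inferInstance) i).trans le_sup_left

namespace IsIndependentThinning

variable {q : E → ℝ}

theorem labels_subset (hΨ : Φ.IsIndependentThinning Ψ q P) (B : Set E) (ω : Ω) :
    Ψ.labels B ω ⊆ Φ.labels B ω := by
  intro i hi
  refine ⟨hΨ.present_subset i hi.1, ?_⟩
  rw [← hΨ.pt_eq]
  exact hi.2

/-- Integration of a function of the original points over the event that given labels are
retained. -/
theorem integral_prod_indicator [IsProbabilityMeasure P] (hΨ : Φ.IsIndependentThinning Ψ q P)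
    {h : E → ℂ} (hm : Measurable h) {C : ℝ} (hC : ∀ x, ‖h x‖ ≤ C) (s : Finset ℕ) :
    ∫ ω, ∏ i ∈ s, (Ψ.present i).indicator (fun ω' => h (Ψ.pt i ω')) ω ∂P =
      ∫ ω, ∏ i ∈ s, (Φ.present i).indicator (fun ω' => q (Φ.pt i ω') * h (Φ.pt i ω')) ω ∂P := by
  let A : Set Ω := ⋂ i ∈ s, Ψ.present i
  have hA : MeasurableSet A := s.measurableSet_biInter fun i _ => Ψ.measurableSet_present i
  let H : Ω → ℂ := fun ω => ∏ i ∈ s, h (Φ.pt i ω)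
  let a : Ω → ℝ := A.indicator fun _ => 1
  have hH : StronglyMeasurable[Φ.sigma] H :=
    (Finset.measurable_prod s fun i _ => hm.comp (Φ.measurable_pt_sigma i)).stronglyMeasurable
  have ha : Integrable a P := (integrable_const 1).indicator hA
  have hHa : Integrable (fun ω => ContinuousLinearMap.lsmul ℝ ℝ (a ω) (H ω)) P := by
    refine ha.smul_bdd (C ^ s.card) (hH.mono Φ.sigma_le).aestronglyMeasurable ?_
    refine .of_forall fun ω => ?_
    rw [norm_prod, ← Finset.prod_const]
    exact Finset.prod_le_prod (fun _ _ => norm_nonneg _) fun i _ => hC _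
  -- `H` depends only on the original points, so it leaves the conditional expectation; the bilinear
  -- form pairs the real `a` with the complex `H`.
  have pull := condExp_bilin_of_stronglyMeasurable_right
    (ContinuousLinearMap.lsmul ℝ ℝ (E := ℂ)) hH hHa ha
  calc ∫ ω, ∏ i ∈ s, (Ψ.present i).indicator (fun ω' => h (Ψ.pt i ω')) ω ∂P
      = ∫ ω, a ω • H ω ∂P := by
        congr with ω
        by_cases hω : ω ∈ A
        · simp only [a, H, indicator_of_mem hω, one_smul, ← hΨ.pt_eq]
          exact Finset.prod_congr rfl fun i hi => indicator_of_mem (mem_iInter₂.1 hω i hi) _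
        · obtain ⟨i, hi, hωi⟩ : ∃ i ∈ s, ω ∉ Ψ.present i := by simpa [A] using hω
          rw [Finset.prod_eq_zero hi (indicator_of_notMem hωi _)]
          simp [a, hω]
    _ = ∫ ω, (P[fun ω => ContinuousLinearMap.lsmul ℝ ℝ (a ω) (H ω) | Φ.sigma]) ω ∂P :=
        (integral_condExp Φ.sigma_le).symm
    _ = ∫ ω, (P[a | Φ.sigma]) ω • H ω ∂P := integral_congr_ae pull
    _ = ∫ ω, ∏ i ∈ s, (Φ.present i).indicator
          (fun ω' => q (Φ.pt i ω') * h (Φ.pt i ω')) ω ∂P := by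
        apply integral_congr_ae
        filter_upwards [hΨ.retention s] with ω hω
        rw [show (P[a | Φ.sigma]) ω = _ from hω, Complex.real_smul, Complex.ofReal_prod,
          ← Finset.prod_mul_distrib]
        refine Finset.prod_congr rfl fun i _ => ?_
        by_cases hi : ω ∈ Φ.present i <;> simp [hi]

/-- `1 + r y` is the convex combination of `1` and `1 + y` with weights `1 - r` and `r`. Hence
thinning preserves admissibility. -/
theorem norm_one_add_mul_le {r : ℝ} (h0 : 0 ≤ r) (h1 : r ≤ 1) {y : ℂ} (hy : ‖1 + y‖ ≤ 1) :
    ‖1 + r * y‖ ≤ 1 := by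
  calc ‖1 + r * y‖ = ‖((1 - r : ℝ) : ℂ) + r * (1 + y)‖ := by
        push_cast
        ring_nf
    _ ≤ ‖((1 - r : ℝ) : ℂ)‖ + ‖(r : ℂ) * (1 + y)‖ := norm_add_le _ _
    _ ≤ (1 - r) + r * 1 := by
        rw [norm_mul, Complex.norm_real, Complex.norm_real, Real.norm_of_nonneg h0,
          Real.norm_of_nonneg (sub_nonneg.2 h1)]
        gcongr
    _ = 1 := by ring

/-- Expand both products over subsets of `s`; the terms agree one by one. -/
theorem integral_prod_factor [IsProbabilityMeasure P] (hΨ : Φ.IsIndependentThinning Ψ q P)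
    (hq : Measurable q) (h0 : ∀ x, 0 ≤ q x) (h1 : ∀ x, q x ≤ 1)
    {h : E → ℂ} (hm : Measurable h) (hh : ∀ x, ‖1 + h x‖ ≤ 1) (s : Finset ℕ) :
    ∫ ω, ∏ i ∈ s, Ψ.factor h ω i ∂P = ∫ ω, ∏ i ∈ s, Φ.factor (fun x => q x * h x) ω i ∂P := by
  have hC {y : ℂ} (hy : ‖1 + y‖ ≤ 1) : ‖y‖ ≤ 2 := by
    calc ‖y‖ = ‖(1 + y) - 1‖ := by ring_nf
      _ ≤ ‖1 + y‖ + ‖(1 : ℂ)‖ := norm_sub_le _ _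
      _ ≤ 2 := by
        rw [norm_one]
        linarith
  have hint (Θ : PointProcess Ω E) {k : E → ℂ} (hk : Measurable k) (hk2 : ∀ x, ‖k x‖ ≤ 2)
      (t : Finset ℕ) :
      Integrable (fun ω => ∏ i ∈ t, (Θ.present i).indicator (fun ω' => k (Θ.pt i ω')) ω) P := by
    refine Integrable.of_bound (Finset.measurable_prod t fun i _ =>
      (hk.comp (Θ.measurable_pt i)).indicator (Θ.measurableSet_present i)).aestronglyMeasurable
      (2 ^ t.card) (.of_forall fun ω => ?_)
    rw [norm_prod, ← Finset.prod_const]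
    refine Finset.prod_le_prod (fun _ _ => norm_nonneg _) fun i _ => ?_
    exact (norm_indicator_le_norm_self _ _).trans (hk2 _)
  have hqm : Measurable fun x => (q x : ℂ) * h x := (Complex.measurable_ofReal.comp hq).mul hm
  simp only [factor, Finset.prod_one_add]
  rw [integral_finsetSum _ fun t _ => hint Ψ hm (fun x => hC (hh x)) t,
    integral_finsetSum _ fun t _ => hint Φ hqm
      (fun x => hC (norm_one_add_mul_le (h0 x) (h1 x) (hh x))) t]
  exact Finset.sum_congr rfl fun t _ => hΨ.integral_prod_indicator hm (fun x => hC (hh x)) t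

/-- The generating functional of an independent thinning of a Poisson process. -/
theorem integral_pointProd [IsProbabilityMeasure P] (hΨ : Φ.IsIndependentThinning Ψ q P)
    (hΦ : Φ.IsPoisson Λ P) (hq : Measurable q) (h0 : ∀ x, 0 ≤ q x) (h1 : ∀ x, q x ≤ 1)
    {h : E → ℂ} {B : Set E} (hm : Measurable h) (hh : ∀ x, ‖1 + h x‖ ≤ 1)
    (hB : ∀ x, x ∉ B → h x = 0) (hBm : MeasurableSet B) (hfin : Λ B < ∞) :
    ∫ ω, Ψ.pointProd h ω ∂P = Complex.exp (∫ x, q x * h x ∂Λ) := by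
  have hqm : Measurable fun x => (q x : ℂ) * h x := (Complex.measurable_ofReal.comp hq).mul hm
  have hqh (x : E) : ‖1 + q x * h x‖ ≤ 1 := norm_one_add_mul_le (h0 x) (h1 x) (hh x)
  have hqB (x : E) (hx : x ∉ B) : (q x : ℂ) * h x = 0 := by rw [hB x hx, mul_zero]
  have hae := hΦ.ae_finite hBm hfin
  rw [← hΦ.integral_pointProd hqm hqh hqB hBm hfin]
  refine tendsto_nhds_unique (tendsto_integral_prod_factor hm hh hB ?_) ?_
  · filter_upwards [hae] with ω hω using hω.subset (hΨ.labels_subset B ω)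
  · simp_rw [hΨ.integral_prod_factor hq h0 h1 hm hh]
    exact tendsto_integral_prod_factor hqm hqh hqB hae

/-- Almost surely no point is retained where the retention probability vanishes. -/
theorem ae_present_imp_mem [IsProbabilityMeasure P] (hΨ : Φ.IsIndependentThinning Ψ q P)
    {D : Set E} (hD : MeasurableSet D) (hqD : ∀ x, x ∉ D → q x = 0) :
    ∀ᵐ ω ∂P, ∀ i, ω ∈ Ψ.present i → Ψ.pt i ω ∈ D := by
  refine ae_all_iff.2 fun i => ?_
  let A : Set Ω := Ψ.present i ∩ Ψ.pt i ⁻¹' Dᶜ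
  have hA : MeasurableSet A := (Ψ.measurableSet_present i).inter (Ψ.measurable_pt i hD.compl)
  -- With the indicator of `Dᶜ` as test function, the left side is `P A` and the right side vanishes
  -- with `q` off `D`.
  have key := hΨ.integral_prod_indicator (h := Dᶜ.indicator fun _ => 1) (C := 1)
    (measurable_const.indicator hD.compl)
    (fun x => (norm_indicator_le_norm_self _ _).trans norm_one.le) {i}
  simp only [Finset.prod_singleton] at key
  have hl : (fun ω => (Ψ.present i).indicator
      (fun ω' => Dᶜ.indicator (fun _ => (1 : ℂ)) (Ψ.pt i ω')) ω) = A.indicator fun _ => 1 := by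
    ext ω
    by_cases h1 : ω ∈ Ψ.present i <;> by_cases h2 : Ψ.pt i ω ∈ D <;> simp [A, h1, h2]
  have hr : (fun ω => (Φ.present i).indicator
      (fun ω' => (q (Φ.pt i ω') : ℂ) * Dᶜ.indicator (fun _ => (1 : ℂ)) (Φ.pt i ω')) ω) = 0 := by
    ext ω
    by_cases h1 : ω ∈ Φ.present i <;> by_cases h2 : Φ.pt i ω ∈ D <;> simp [h1, h2, hqD]
  rw [hl, hr, integral_indicator_const _ hA] at key
  have hA0 : P A = 0 := by simpa [measureReal_eq_zero_iff] using key
  filter_upwards [measure_eq_zero_iff_ae_notMem.1 hA0] with ω hω hi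
  by_contra hx
  exact hω ⟨hi, hx⟩

/-- An independent thinning of a Poisson process is a Poisson process, if the retention probability
vanishes outside a set of finite intensity. -/
theorem isPoisson [IsProbabilityMeasure P] (hΨ : Φ.IsIndependentThinning Ψ q P)
    (hΦ : Φ.IsPoisson Λ P) (hq : Measurable q) (h0 : ∀ x, 0 ≤ q x) (h1 : ∀ x, q x ≤ 1)
    {D : Set E} (hD : MeasurableSet D) (hqD : ∀ x, x ∉ D → q x = 0) (hfin : Λ D < ∞) :
    Ψ.IsPoisson (Λ.withDensity fun x => ENNReal.ofReal (q x)) P := by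
  have hmem := hΨ.ae_present_imp_mem hD hqD
  -- A set of finite thinned intensity may have infinite `Λ`-measure, so everything is restricted to
  -- `D`.
  have hlabels (B : Set E) : ∀ᵐ ω ∂P, Ψ.labels B ω = Ψ.labels (B ∩ D) ω := by
    filter_upwards [hmem] with ω hω
    ext i
    exact ⟨fun hi => ⟨hi.1, hi.2, hω i hi.1⟩, fun hi => ⟨hi.1, hi.2.1⟩⟩
  have hfinite (B : Set E) : ∀ᵐ ω ∂P, (Ψ.labels (B ∩ D) ω).Finite := by
    filter_upwards [hΦ.ae_finite hD hfin] with ω hω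
    exact (hω.subset (hΨ.labels_subset D ω)).subset (labels_mono inter_subset_right ω)
  refine isPoisson_of_map_num (fun B _ _ => ?_) fun n B hB _ hdisj => ?_
  · filter_upwards [hlabels B, hfinite B] with ω h1 h2
    rwa [h1]
  have hBD (j : Fin n) : MeasurableSet (B j ∩ D) := (hB j).inter hD
  have hBDfin (j : Fin n) : Λ (B j ∩ D) < ∞ := (measure_mono inter_subset_right).trans_lt hfin
  have hdisjD : Pairwise fun i j => Disjoint (B i ∩ D) (B j ∩ D) := fun i j hij =>
    (hdisj hij).mono inter_subset_left inter_subset_left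
  have hmap : P.map (fun ω j => Ψ.num (B j) ω) = P.map (fun ω j => Ψ.num (B j ∩ D) ω) := by
    refine Measure.map_congr ?_
    filter_upwards [ae_all_iff.2 fun j => hlabels (B j)] with ω hω
    ext j
    simp only [num, hω j]
  have hmean (j : Fin n) : ((Λ.withDensity fun x => ENNReal.ofReal (q x)) (B j)).toNNReal =
      ∫ x in B j ∩ D, q x ∂Λ := by
    rw [integral_eq_lintegral_of_nonneg_ae (.of_forall h0) hq.aestronglyMeasurable,
      withDensity_apply _ (hB j), ENNReal.coe_toNNReal_eq_toReal,
      ← lintegral_inter_add_sdiff _ (B j) hD,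
      setLIntegral_congr_fun (g := fun _ => 0) ((hB j).diff hD) (fun x hx => by simp [hqD x hx.2])]
    simp
  have hnum : Measurable fun ω j => Ψ.num (B j ∩ D) ω :=
    measurable_pi_lambda _ fun j => Ψ.measurable_num (hBD j)
  have : IsProbabilityMeasure (P.map fun ω j => Ψ.num (B j ∩ D) ω) :=
    Measure.isProbabilityMeasure_map hnum.aemeasurable
  rw [hmap]
  refine ext_of_integral_prod_pow fun z hz => ?_
  rw [integral_map hnum.aemeasurable Measurable.of_discrete.aestronglyMeasurable,
    integral_fintype_prod_eq_prod (f := fun j (n : ℕ) => z j ^ n)]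
  simp_rw [integral_pow_poissonMeasure]
  -- Chosen so that `1 + h = z j` on `B j ∩ D` and `1 + h = 1` elsewhere.
  let h : E → ℂ := fun x => ∑ j, (B j ∩ D).indicator (fun _ => z j - 1) x
  have hm : Measurable h :=
    Finset.measurable_sum _ fun j _ => measurable_const.indicator (hBD j)
  have hh (x : E) : ‖1 + h x‖ ≤ 1 := by
    rw [one_add_sum_indicator hdisjD, norm_prod]
    refine Finset.prod_le_one (fun _ _ => norm_nonneg _) fun j _ => ?_
    by_cases hx : x ∈ B j ∩ D
    · rw [indicator_of_mem hx, add_sub_cancel, hz]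
    · rw [indicator_of_notMem hx, add_zero, norm_one]
  calc ∫ ω, ∏ j, z j ^ Ψ.num (B j ∩ D) ω ∂P = ∫ ω, Ψ.pointProd h ω ∂P := by
        apply integral_congr_ae
        filter_upwards [ae_all_iff.2 fun j => hfinite (B j)] with ω hω
        rw [pointProd_sum_indicator hdisjD _ hω]
        simp
    _ = Complex.exp (∫ x, q x * h x ∂Λ) :=
        hΨ.integral_pointProd hΦ hq h0 h1 hm hh
          (fun x hx => sum_indicator_eq_zero _ fun j hj => hx hj.2) hD hfin
    _ = Complex.exp (∑ j, (∫ x in B j ∩ D, q x ∂Λ : ℝ) * (z j - 1)) := by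
        congr 1
        have hterm (j : Fin n) (x : E) :
            (q x : ℂ) * (B j ∩ D).indicator (fun _ => z j - 1) x =
              (B j ∩ D).indicator (fun x => (q x : ℂ) * (z j - 1)) x := by
          by_cases hx : x ∈ B j ∩ D <;> simp [hx]
        simp_rw [h, Finset.mul_sum, hterm]
        rw [integral_finsetSum]
        · refine Finset.sum_congr rfl fun j _ => ?_
          rw [integral_indicator (hBD j), integral_mul_const, integral_complex_ofReal]
        · intro j _
          refine (integrable_indicator_iff (hBD j)).2 (Integrable.mul_const ?_ _)
          refine Measure.integrableOn_of_bounded (M := 1) (hBDfin j).ne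
            (Complex.measurable_ofReal.comp hq).aestronglyMeasurable (.of_forall fun x => ?_)
          rw [Complex.norm_real, Real.norm_of_nonneg (h0 x)]
          exact h1 x
    _ = _ := by
        rw [Complex.exp_sum]
        refine Finset.prod_congr rfl fun j _ => ?_
        rw [← hmean j]

end IsIndependentThinning

end PointProcess

/-! ### The visible region -/

/-- For `m ≠ 0` the equation says that the line of sight to `p` meets the obstacle at `m`; the
obstacle at the origin is a point on every line of sight. -/
theorem not_disjoint_segment_obstacle_iff {L : ℝ} (hL : 0 < L) (p m : Plane) :
    ¬ Disjoint (segment ℝ 0 p) (obstacle L m) ↔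
      ∃ y ∈ Icc (0 : ℝ) 1 ×ˢ Icc (-(L / 2)) (L / 2),
        (y.1 * ‖m‖) • p = ‖m‖ • m + y.2 • !₂[-(m 1), m 0] := by
  rw [Set.not_disjoint_iff]
  by_cases hm : m = 0
  · subst hm
    refine iff_of_true ⟨0, left_mem_segment ℝ 0 p, 0, by simpa using (half_pos hL).le, by simp⟩
      ⟨(0, 0), ⟨by simp, by simpa using (half_pos hL).le⟩, ?_⟩
    ext i
    fin_cases i <;> simp
  have hm' : ‖m‖ ≠ 0 := norm_ne_zero_iff.2 hm
  -- Clearing `‖m‖⁻¹` leaves an equation between functions that are continuous in all variables,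
  -- also at `m = 0`.
  have hscale (s t : ℝ) : s • p = m + (t * ‖m‖⁻¹) • !₂[-(m 1), m 0] ↔
      (s * ‖m‖) • p = ‖m‖ • m + t • !₂[-(m 1), m 0] := by
    rw [← smul_right_inj hm', smul_add, smul_smul, smul_smul, mul_comm ‖m‖ s, mul_comm ‖m‖ (t * _),
      inv_mul_cancel_right₀ hm']
  constructor
  · rintro ⟨x, hx, t, ht, hxt⟩
    rw [segment_eq_image'] at hx
    obtain ⟨s, hs, rfl⟩ := hx
    refine ⟨(s, t), ⟨hs, abs_le.1 ht⟩, (hscale s t).1 ?_⟩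
    simpa using hxt
  · rintro ⟨⟨s, t⟩, ⟨hs, ht⟩, hst⟩
    refine ⟨s • p, ?_, t, abs_le.2 ht, (hscale s t).2 hst⟩
    rw [segment_eq_image']
    exact ⟨s, hs, by simp⟩

/-- The set is the projection of a closed set along the compact rectangle of the parameters on the
line of sight and on the obstacle. -/
theorem isClosed_setOf_not_disjoint_segment_obstacle {L : ℝ} (hL : 0 < L) :
    IsClosed {x : Plane × Plane | ¬ Disjoint (segment ℝ 0 x.1) (obstacle L x.2)} := by
  let K : Set (ℝ × ℝ) := Icc 0 1 ×ˢ Icc (-(L / 2)) (L / 2)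
  have hK : IsCompact K := isCompact_Icc.prod isCompact_Icc
  have : CompactSpace K := isCompact_iff_compactSpace.1 hK
  let C : Set (K × (Plane × Plane)) := {w | (w.1.1.1 * ‖w.2.2‖) • w.2.1 =
    ‖w.2.2‖ • w.2.2 + w.1.1.2 • !₂[-(w.2.2 1), w.2.2 0]}
  have hC : IsClosed C := by
    have hrot : Continuous fun m : Plane => (!₂[-(m 1), m 0] : Plane) := by
      refine (PiLp.continuous_toLp 2 _).comp (continuous_pi fun i => ?_)
      fin_cases i <;> simp <;> fun_prop
    have hrot' : Continuous fun w : K × (Plane × Plane) =>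
        (!₂[-(w.2.2 1), w.2.2 0] : Plane) := hrot.comp (continuous_snd.comp continuous_snd)
    exact isClosed_eq (by fun_prop) (by fun_prop)
  convert! isClosedMap_snd_of_compactSpace C hC using 1
  ext ⟨p, m⟩
  simp only [mem_ofPred_eq, not_disjoint_segment_obstacle_iff hL]
  constructor
  · rintro ⟨y, hy, h⟩
    exact ⟨(⟨y, hy⟩, p, m), h, rfl⟩
  · rintro ⟨⟨⟨y, hy⟩, _, _⟩, h, heq⟩
    obtain ⟨rfl, rfl⟩ := Prod.mk.inj heq
    exact ⟨y, hy, h⟩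

section Visibility

variable {Ω : Type*} [MeasurableSpace Ω] (Ξ : PointProcess Ω Plane) {L : ℝ} (R : ℝ)

/-- Visibility is a countable intersection over obstacle labels. Joint measurability in `(p, ω)` is
what Tonelli's theorem requires. -/
theorem measurableSet_setOf_mem_visibleRegion (hL : 0 < L) :
    MeasurableSet {x : Plane × Ω | x.1 ∈ visibleRegion Ξ L R x.2} := by
  have h : {x : Plane × Ω | x.1 ∈ visibleRegion Ξ L R x.2} =
      Prod.fst ⁻¹' disc R ∩ ⋂ i, ((Prod.snd ⁻¹' Ξ.present i)ᶜ ∪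
        ((fun x : Plane × Ω => (x.1, Ξ.pt i x.2)) ⁻¹'
          {x | ¬ Disjoint (segment ℝ 0 x.1) (obstacle L x.2)})ᶜ) := by
    ext x
    simp [visibleRegion, imp_iff_not_or]
  rw [h]
  refine (measurable_fst Metric.isClosed_closedBall.measurableSet).inter (.iInter fun i => ?_)
  refine (measurable_snd (Ξ.measurableSet_present i)).compl.union (MeasurableSet.compl ?_)
  exact (measurable_fst.prodMk ((Ξ.measurable_pt i).comp measurable_snd))
    (isClosed_setOf_not_disjoint_segment_obstacle hL).measurableSet

variable (P : Measure Ω)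

theorem visibleProb_eq_zero {p : Plane} (hp : p ∉ disc R) : visibleProb Ξ L R P p = 0 := by
  have : {ω | p ∈ visibleRegion Ξ L R ω} = ∅ := eq_empty_of_forall_notMem fun ω hω => hp hω.1
  rw [visibleProb, this, measure_empty]

variable [IsProbabilityMeasure P]

theorem measurable_visibleProb (hL : 0 < L) : Measurable (visibleProb Ξ L R P) :=
  measurable_measure_prodMk_left (measurableSet_setOf_mem_visibleRegion Ξ R hL)

theorem visibleProb_le_one (p : Plane) : visibleProb Ξ L R P p ≤ 1 := prob_le_one

theorem volume_visibleRegion_le (ω : Ω) : volume (visibleRegion Ξ L R ω) ≤ volume (disc R) :=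
  measure_mono fun _ hp => hp.1

theorem volume_disc_lt_top : volume (disc R) < ∞ := measure_closedBall_lt_top

theorem measurable_volume_visibleRegion (hL : 0 < L) :
    Measurable fun ω => volume (visibleRegion Ξ L R ω) :=
  measurable_measure_prodMk_right (measurableSet_setOf_mem_visibleRegion Ξ R hL)

theorem integrable_visibleArea (hL : 0 < L) : Integrable (visibleArea Ξ L R) P := by
  refine Integrable.of_bound
    (measurable_volume_visibleRegion Ξ R hL).ennreal_toReal.aestronglyMeasurable
    (volume (disc R)).toReal (.of_forall fun ω => ?_)
  rw [visibleArea, Real.norm_of_nonneg ENNReal.toReal_nonneg]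
  exact ENNReal.toReal_mono (volume_disc_lt_top R).ne (volume_visibleRegion_le Ξ R ω)

/-- The mean visible area is the integral of the visibility probability. -/
theorem lintegral_visibleProb (hL : 0 < L) :
    ∫⁻ p, visibleProb Ξ L R P p = ENNReal.ofReal (∫ ω, visibleArea Ξ L R ω ∂P) := by
  have hmeas := measurableSet_setOf_mem_visibleRegion Ξ R hL
  calc ∫⁻ p, visibleProb Ξ L R P p
      = (volume.prod P) {x : Plane × Ω | x.1 ∈ visibleRegion Ξ L R x.2} :=
        (Measure.prod_apply hmeas).symm
    _ = ∫⁻ ω, volume (visibleRegion Ξ L R ω) ∂P := Measure.prod_apply_symm hmeas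
    _ = ∫⁻ ω, ENNReal.ofReal (visibleArea Ξ L R ω) ∂P := lintegral_congr fun ω =>
        (ENNReal.ofReal_toReal
          ((volume_visibleRegion_le Ξ R ω).trans_lt (volume_disc_lt_top R)).ne).symm
    _ = ENNReal.ofReal (∫ ω, visibleArea Ξ L R ω ∂P) :=
        (ofReal_integral_eq_lintegral_ofReal (integrable_visibleArea Ξ R P hL)
          (.of_forall fun _ => ENNReal.toReal_nonneg)).symm

theorem setLIntegral_disc_visibleProb (hL : 0 < L) (lam : ℝ≥0) :
    ∫⁻ p in disc R, (lam : ℝ≥0∞) * visibleProb Ξ L R P p =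
      ENNReal.ofReal (lam * ∫ ω, visibleArea Ξ L R ω ∂P) := by
  rw [lintegral_const_mul _ (measurable_visibleProb Ξ R P hL), setLIntegral_eq_of_support_subset,
    lintegral_visibleProb Ξ R P hL, ENNReal.ofReal_mul lam.coe_nonneg]
  · congr 1
    exact ENNReal.ofReal_coe_nnreal.symm
  · intro p hp
    by_contra hp'
    exact hp (visibleProb_eq_zero Ξ R P hp')

end Visibility

/-! ### The blind spot probability -/

theorem g_eq {a : ℝ} (ha : 0 ≤ a) (lam : ℝ≥0) :
    g a lam = Real.exp (-(lam * a)) * (1 + lam * a + (lam * a) ^ 2 / 2) := by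
  simp only [g, poissonMeasure_real_singleton, Finset.sum_range_succ, Finset.sum_range_zero,
    NNReal.coe_mul, Real.coe_toNNReal a ha]
  norm_num [Nat.factorial]
  ring

/-- A count below three cannot be `⊤`, so the event splits into the disjoint events of count `0`,
`1` and `2`. -/
theorem PointProcess.IsPoisson.blindSpotProb_eq_g {Ω : Type*} [MeasurableSpace Ω] {P : Measure Ω}
    [IsProbabilityMeasure P] {Ψ : PointProcess Ω Plane} {Λ : Measure Plane}
    (hΨ : Ψ.IsPoisson Λ P) {R a : ℝ} {lam : ℝ≥0} (ha : Λ (disc R) = ENNReal.ofReal (lam * a)) :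
    blindSpotProb Ψ R P = g a lam := by
  have hD : MeasurableSet (disc R) := Metric.isClosed_closedBall.measurableSet
  have hm : Measurable (Ψ.count (disc R)) := measurable_encard.comp (Ψ.measurable_labels hD)
  have hfin : Λ (disc R) < ∞ := ha ▸ ENNReal.ofReal_lt_top
  have hk (k : ℕ) : P.real {ω | Ψ.count (disc R) ω = k} =
      (poissonMeasure (lam * a.toNNReal)).real {k} := by
    have := hΨ.measure_eq (ι := Unit) (B := fun _ => disc R) (fun _ => hD) (fun _ => hfin)
      (fun i j hij => (hij rfl).elim) (fun _ => k)
    simp only [forall_const, Finset.univ_unique, Finset.prod_const, Finset.card_singleton,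
      pow_one] at this
    rw [measureReal_def, measureReal_def, this, ha, ENNReal.ofReal, ENNReal.toNNReal_coe,
      Real.toNNReal_mul lam.coe_nonneg, Real.toNNReal_coe]
  have hset : {ω | Ψ.count (disc R) ω < 3} =
      ⋃ k ∈ Finset.range 3, {ω | Ψ.count (disc R) ω = (k : ℕ)} := by
    ext ω
    simp only [mem_ofPred_eq, Finset.mem_range, mem_iUnion, exists_prop]
    constructor
    · intro h
      obtain ⟨k, hk⟩ := ENat.ne_top_iff_exists.1 (ne_top_of_lt h)
      rw [← hk] at h
      exact ⟨k, by exact_mod_cast h, hk.symm⟩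
    · rintro ⟨k, hk, h⟩
      rw [h]
      exact_mod_cast hk
  rw [blindSpotProb, hset, measureReal_biUnion_finset, g]
  · exact Finset.sum_congr rfl fun k _ => hk k
  · intro k _ l _ hkl
    refine Set.disjoint_left.2 fun ω hk hl => hkl ?_
    exact Nat.cast_injective (R := ℕ∞) (hk.symm.trans hl)
  · exact fun k _ => hm (measurableSet_singleton _)

end BlindSpot

theorem lemma1 {Ω : Type*} [MeasurableSpace Ω] (P : Measure Ω) [IsProbabilityMeasure P]
    (lam lam₀ : ℝ≥0) (hlam : 0 < lam) (hlam₀ : 0 < lam₀) (L R : ℝ) (hL : 0 < L) (hR : 0 < R)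
    -- the obstacle mid-points and the anchors are homogeneous Poisson point processes
    (obstacles anchors : BlindSpot.PointProcess Ω BlindSpot.Plane)
    (hobstacles : obstacles.IsPoisson (lam₀ • volume) P)
    (hanchors : anchors.IsPoisson (lam • volume) P)
    -- independent blocking: an anchor at `p` is visible with the probability that `p` is visible,
    -- independently of the other anchors
    (visible : BlindSpot.PointProcess Ω BlindSpot.Plane)
    (hvisible : anchors.IsIndependentThinning visible
      (fun p => (BlindSpot.visibleProb obstacles L R P p).toReal) P) :
    -- the visible anchors form an inhomogeneous Poisson point process
    visible.IsPoisson
        (volume.withDensity fun p => (lam : ℝ≥0∞) * BlindSpot.visibleProb obstacles L R P p) P ∧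
      -- whose mean number of points in the disc is `lam` times the mean visible area
      Integrable (BlindSpot.visibleArea obstacles L R) P ∧
      (∫⁻ p in BlindSpot.disc R, (lam : ℝ≥0∞) * BlindSpot.visibleProb obstacles L R P p) =
        ENNReal.ofReal (lam * ∫ ω, BlindSpot.visibleArea obstacles L R ω ∂P) ∧
      (∫⁻ ω, (visible.count (BlindSpot.disc R) ω : ℝ≥0∞) ∂P) =
        ENNReal.ofReal (lam * ∫ ω, BlindSpot.visibleArea obstacles L R ω ∂P) ∧
      -- and the blind spot probability is a function of the mean visible area
      BlindSpot.blindSpotProb visible R P =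
        Real.exp (-(lam * ∫ ω, BlindSpot.visibleArea obstacles L R ω ∂P)) *
          (1 + lam * (∫ ω, BlindSpot.visibleArea obstacles L R ω ∂P) +
            (lam * ∫ ω, BlindSpot.visibleArea obstacles L R ω ∂P) ^ 2 / 2) ∧
      BlindSpot.blindSpotProb visible R P =
        BlindSpot.g (∫ ω, BlindSpot.visibleArea obstacles L R ω ∂P) lam := by
  -- `g` truncates its argument at zero, so its closed form needs this sign.
  have harea : 0 ≤ ∫ ω, BlindSpot.visibleArea obstacles L R ω ∂P :=
    integral_nonneg fun _ => ENNReal.toReal_nonneg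
  have hD : MeasurableSet (BlindSpot.disc R) := Metric.isClosed_closedBall.measurableSet
  have hle := BlindSpot.visibleProb_le_one (L := L) obstacles R P
  have hmeas := BlindSpot.measurable_visibleProb obstacles R P hL
  -- The factor `lam` moves from the base measure into the density; passing through `toReal` loses
  -- nothing because probabilities are finite.
  have hΛ : (lam • volume).withDensity
        (fun p => ENNReal.ofReal (BlindSpot.visibleProb obstacles L R P p).toReal) =
      volume.withDensity fun p => (lam : ℝ≥0∞) * BlindSpot.visibleProb obstacles L R P p := by
    simp_rw [fun p => ENNReal.ofReal_toReal ((hle p).trans_lt ENNReal.one_lt_top).ne]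
    refine (withDensity_smul_measure (lam : ℝ≥0∞) _).trans ?_
    exact (withDensity_smul _ hmeas).symm
  have hpois := hvisible.isPoisson hanchors hmeas.ennreal_toReal
    (fun _ => ENNReal.toReal_nonneg)
    (fun p => by simpa using ENNReal.toReal_mono ENNReal.one_ne_top (hle p)) hD
    (fun p hp => by simp [BlindSpot.visibleProb_eq_zero obstacles R P hp])
    (by
      rw [Measure.smul_apply]
      exact ENNReal.mul_lt_top ENNReal.coe_lt_top (BlindSpot.volume_disc_lt_top R))
  rw [hΛ] at hpois
  have hint := BlindSpot.setLIntegral_disc_visibleProb obstacles R P hL lam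
  have hmean := hint
  rw [← withDensity_apply _ hD] at hmean
  have hblind := hpois.blindSpotProb_eq_g hmean
  refine ⟨hpois, BlindSpot.integrable_visibleArea obstacles R P hL, hint, ?_, ?_, hblind⟩
  · rw [hpois.lintegral_count hD (hmean ▸ ENNReal.ofReal_lt_top), hmean]
  · rw [hblind, BlindSpot.g_eq harea]
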